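/- **Theorem 3.5.** Let $M$ and $N$ be smooth manifolds, $\dim M=n+p$, $\dim N=p$, and let $\pi:(M,g_0)\to(N,g_N)$ be a Riemannian submersion: $\pi$ is smooth, $\pi_*$ is surjective at every point, and $g_0(X,Y)=g_N(\pi_*X,\pi_*Y)$ for all $X,Y$ that are $g_0$-orthogonal to the vertical distribution $\mathcal V=\ker\pi_*$. A vector field $X$ is called bounded on $(M,g)$ if $g(X,X)$ is a bounded function. For $\epsilon>0$, a variation of $g_0$ is a family $\{g_t,\ t\in(-\epsilon,\epsilon)\}$ of smooth Riemannian metrics on $M$ that passes through $g_0$ at $t=0$ and depends smoothly on $(t,x)\in(-\epsilon,\epsilon)\times M$. It is fixed on the fibers if $g_t(X,Y)=g_0(X,Y)$ for all vertical $X,Y$ and all $t$, and it preserves the Riemannian submersion $\pi$ if $\pi:(M,g_t)\to(N,g_N)$ is a Riemannian submersion for all $t\in(-\epsilon,\epsilon)$. Put $B_t=\partial_t g_t$, and let $B_t^\sharp$ be defined by $g_t(B_t^\sharp X,Y)=B_t(X,Y)$ for all $X,Y$. Let $P_{\mathcal H}^t$ be the $g_t$-orthogonal projection onto the $g_t$-orthogonal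 complement of $\mathcal V$. Let $V_{n+1},\dots,V_{n+p}$ be smooth vertical vector fields on $M$, bounded on $(M,g_0)$, and let $W_{n+1},\dots,W_{n+p}$ be smooth vector fields on $N$, linearly independent at every point and bounded on $(N,g_N)$. Let $\pi^*W_i$ be the $g_0$-horizontal lift of $W_i$, i.e. the unique vector field on $M$ that is $g_0$-orthogonal to $\mathcal V$ and satisfies $\pi_*(\pi^*W_i)=W_i$. Then there exist $\epsilon>0$ and a variation $\{g_t,\ t\in(-\epsilon,\epsilon)\}$ of $g_0$ that is fixed on the fibers, preserves the Riemannian submersion $\pi$, and satisfies, for all $t\in(-\epsilon,\epsilon)$ and all vertical $X$, $$B_t^\sharp X=\sum_{i=n+1}^{n+p} g_0(V_i,X)\,P_{\mathcal H}^t\,\pi^*W_i .$$ Moreover, such a variation is unique: for every $\epsilon>0$, any two variations on $(-\epsilon,\epsilon)$ with these properties coincide. -/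

import Mathlib

open Set Manifold
open scoped ContDiff Topology

noncomputable section

/-- The model space `ℝ^d` of `d`-dimensional manifolds. -/
abbrev Eucl (d : ℕ) : Type := EuclideanSpace ℝ (Fin d)

/-- The tangent space at `x` of a manifold of dimension `d`. -/
abbrev Tan (d : ℕ) {M : Type*} [TopologicalSpace M] [ChartedSpace (Eucl d) M] (x : M) : Type :=
  TangentSpace (𝓡 d) x

/-- Smooth Riemannian metrics on a `d`-dimensional smooth manifold. -/
abbrev SmoothMetric (d : ℕ) (M : Type*) [TopologicalSpace M] [ChartedSpace (Eucl d) M]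
    [IsManifold (𝓡 d) ∞ M] :=
  Bundle.ContMDiffRiemannianMetric (𝓡 d) ∞ (Eucl d) (fun x : M => Tan d x)

/-- Smooth vector fields on a `d`-dimensional smooth manifold. -/
abbrev SmoothVectorField (d : ℕ) (M : Type*) [TopologicalSpace M] [ChartedSpace (Eucl d) M]
    [IsManifold (𝓡 d) ∞ M] :=
  ContMDiffSection (𝓡 d) (Eucl d) ∞ (fun x : M => Tan d x)

section Metric

variable {d : ℕ} {M : Type*} [TopologicalSpace M] [ChartedSpace (Eucl d) M]

instance (x : M) : FiniteDimensional ℝ (Tan d x) :=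
  inferInstanceAs (FiniteDimensional ℝ (Eucl d))

/-- The underlying algebraic bilinear form of a continuous bilinear form on a tangent space. -/
def toBilin {x : M} (b : Tan d x →L[ℝ] Tan d x →L[ℝ] ℝ) : LinearMap.BilinForm ℝ (Tan d x) :=
  LinearMap.mk₂ ℝ (fun X Y => b X Y) (by simp) (by simp) (by simp) (by simp)

@[simp] theorem toBilin_apply {x : M} (b : Tan d x →L[ℝ] Tan d x →L[ℝ] ℝ) (X Y : Tan d x) :
    toBilin b X Y = b X Y := rfl

variable [IsManifold (𝓡 d) ∞ M]

/-- A vector field `X` is bounded with respect to `g` if `g(X, X)` is a bounded function. -/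
def IsBoundedField (g : SmoothMetric d M) (X : SmoothVectorField d M) : Prop :=
  ∃ C : ℝ, ∀ x : M, g.inner x (X x) (X x) ≤ C

theorem toBilin_isRefl (g : SmoothMetric d M) (x : M) :
    LinearMap.IsRefl (toBilin (g.inner x)) := by
  intro X Y h
  simpa [g.symm x Y X] using h

theorem toBilin_nondegenerate (g : SmoothMetric d M) (x : M) :
    (toBilin (g.inner x)).Nondegenerate := by
  constructor
  · intro X h
    by_contra hX
    exact (g.pos x X hX).ne' (h X)
  · intro X h
    by_contra hX
    exact (g.pos x X hX).ne' (h X)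

/-- Raising an index: the linear map `b^♯` with `g (b^♯ X, Y) = b (X, Y)`. -/
def sharp (g : SmoothMetric d M) (x : M) (b : Tan d x →L[ℝ] Tan d x →L[ℝ] ℝ) :
    Tan d x →ₗ[ℝ] Tan d x :=
  (toBilin b).symmCompOfNondegenerate (toBilin (g.inner x)) (toBilin_nondegenerate g x)

theorem inner_sharp (g : SmoothMetric d M) (x : M) (b : Tan d x →L[ℝ] Tan d x →L[ℝ] ℝ)
    (X Y : Tan d x) : g.inner x (sharp g x b X) Y = b X Y :=
  LinearMap.BilinForm.symmCompOfNondegenerate_left_apply (toBilin b)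
    (toBilin_nondegenerate g x) Y X

/-- `B_t = ∂_t g_t` at the point `x`. -/
def metricDeriv (g : ℝ → SmoothMetric d M) (t : ℝ) (x : M) :
    Tan d x →L[ℝ] Tan d x →L[ℝ] ℝ :=
  deriv (fun s => (g s).inner x) t

/-- `B_t^♯` at the point `x`, defined by `g_t (B_t^♯ X, Y) = B_t (X, Y)`. -/
def metricDerivSharp (g : ℝ → SmoothMetric d M) (t : ℝ) (x : M) : Tan d x →ₗ[ℝ] Tan d x :=
  sharp (g t) x (metricDeriv g t x)

/-- `{g_t, t ∈ (-ε, ε)}` is a variation of `g₀`: it passes through `g₀` at `t = 0`, and depends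
smoothly on `t`, i.e. `(t, x) ↦ g_t(x)` is smooth on `(-ε, ε) × M`. Only the restriction of the
function `g` to `(-ε, ε)` is meaningful. -/
structure IsVariation (g₀ : SmoothMetric d M) (ε : ℝ) (g : ℝ → SmoothMetric d M) : Prop where
  zero : g 0 = g₀
  contMDiffOn : ContMDiffOn (𝓘(ℝ, ℝ).prod (𝓡 d)) ((𝓡 d).prod 𝓘(ℝ, Eucl d →L[ℝ] Eucl d →L[ℝ] ℝ)) ∞
    (fun q : ℝ × M => Bundle.TotalSpace.mk' (Eucl d →L[ℝ] Eucl d →L[ℝ] ℝ)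
      (E := fun x : M => Tan d x →L[ℝ] Tan d x →L[ℝ] ℝ) q.2 ((g q.1).inner q.2))
    (Ioo (-ε) ε ×ˢ univ)

end Metric

section Submersion

variable {d p : ℕ} {M N : Type*}
  [TopologicalSpace M] [ChartedSpace (Eucl d) M] [IsManifold (𝓡 d) ∞ M]
  [TopologicalSpace N] [ChartedSpace (Eucl p) N]

/-- The differential `π_*` at `x`. -/
def pushforward (d p : ℕ) {M N : Type*} [TopologicalSpace M] [ChartedSpace (Eucl d) M]
    [TopologicalSpace N] [ChartedSpace (Eucl p) N] (π : M → N) (x : M) :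
    Tan d x →L[ℝ] Tan p (π x) :=
  mfderiv (𝓡 d) (𝓡 p) π x

/-- The vertical space `ker π_*` at `x`. -/
def verticalSpace (d p : ℕ) {M N : Type*} [TopologicalSpace M] [ChartedSpace (Eucl d) M]
    [TopologicalSpace N] [ChartedSpace (Eucl p) N] (π : M → N) (x : M) :
    Submodule ℝ (Tan d x) :=
  LinearMap.ker (pushforward d p π x).toLinearMap

/-- The `g`-horizontal space at `x`: the `g`-orthogonal complement of the vertical space. -/
def horizontalSpace (p : ℕ) {N : Type*} [TopologicalSpace N] [ChartedSpace (Eucl p) N]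
    (g : SmoothMetric d M) (π : M → N) (x : M) : Submodule ℝ (Tan d x) :=
  (toBilin (g.inner x)).orthogonal (verticalSpace d p π x)

theorem isCompl_vertical_horizontal (g : SmoothMetric d M) (π : M → N) (x : M) :
    IsCompl (verticalSpace d p π x) (horizontalSpace p g π x) := by
  refine (LinearMap.BilinForm.isCompl_orthogonal_iff_disjoint (toBilin_isRefl g x)).2 ?_
  rw [Submodule.disjoint_def]
  intro X hX hX'
  by_contra h0
  exact (g.pos x X h0).ne' (hX' X hX)

/-- The `g`-orthogonal projection `P_ℋ` onto the `g`-horizontal space at `x`. -/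
def horizontalProj (p : ℕ) {N : Type*} [TopologicalSpace N] [ChartedSpace (Eucl p) N] (g : SmoothMetric d M) (π : M → N) (x : M) :
    Tan d x →ₗ[ℝ] Tan d x :=
  (horizontalSpace p g π x).projection (verticalSpace d p π x)
    (isCompl_vertical_horizontal g π x).symm

variable [IsManifold (𝓡 p) ∞ N]

/-- `π : (M, g) → (N, gN)` is a Riemannian submersion. -/
structure IsRiemannianSubmersion (g : SmoothMetric d M) (gN : SmoothMetric p N) (π : M → N) :
    Prop where
  contMDiff : ContMDiff (𝓡 d) (𝓡 p) ∞ π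
  surjective : ∀ x : M, Function.Surjective (pushforward d p π x)
  isometry : ∀ x : M, ∀ X ∈ horizontalSpace p g π x, ∀ Y ∈ horizontalSpace p g π x,
    g.inner x X Y = gN.inner (π x) (pushforward d p π x X) (pushforward d p π x Y)

theorem existsUnique_horizontal {g : SmoothMetric d M} {gN : SmoothMetric p N} {π : M → N}
    (hπ : IsRiemannianSubmersion g gN π) (x : M) (w : Tan p (π x)) :
    ∃! Z : Tan d x, Z ∈ horizontalSpace p g π x ∧ pushforward d p π x Z = w := by
  obtain ⟨Y, hY⟩ := hπ.surjective x w
  have hc := isCompl_vertical_horizontal (p := p) g π x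
  obtain ⟨U, hU, Z, hZ, rfl⟩ := Submodule.mem_sup.1
    (show Y ∈ verticalSpace d p π x ⊔ horizontalSpace p g π x by
      rw [hc.sup_eq_top]; trivial)
  have hU' : pushforward d p π x U = 0 := hU
  refine ⟨Z, ⟨hZ, by simpa [hU'] using hY⟩, ?_⟩
  rintro Z' ⟨hZ', hw⟩
  have h1 : Z' - Z ∈ verticalSpace d p π x := by
    change pushforward d p π x (Z' - Z) = 0
    rw [map_sub, hw, ← hY, map_add, hU', zero_add, sub_self]
  exact sub_eq_zero.1 ((Submodule.disjoint_def.1 hc.disjoint) _ h1 (Submodule.sub_mem _ hZ' hZ))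

/-- The `g`-horizontal lift `π^* W` of a vector field `W` on `N`: at `x` it is the unique
`g`-horizontal vector mapped by `π_*` to `W (π x)`. -/
def horizontalLift {g : SmoothMetric d M} {gN : SmoothMetric p N} {π : M → N}
    (hπ : IsRiemannianSubmersion g gN π) (W : SmoothVectorField p N) (x : M) : Tan d x :=
  (existsUnique_horizontal hπ x (W (π x))).choose

/-- `{g_t, t ∈ (-ε, ε)}` is contained in `Riem(M, 𝒱, g₀)`: all `g_t` agree with `g₀` on the
vertical distribution of `π`. -/
def IsFixedOnFibers (p : ℕ) {N : Type*} [TopologicalSpace N] [ChartedSpace (Eucl p) N]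
    (g₀ : SmoothMetric d M) (π : M → N) (ε : ℝ) (g : ℝ → SmoothMetric d M) : Prop :=
  ∀ t ∈ Ioo (-ε) ε, ∀ x : M, ∀ X ∈ verticalSpace d p π x, ∀ Y ∈ verticalSpace d p π x,
    (g t).inner x X Y = g₀.inner x X Y

/-- `{g_t, t ∈ (-ε, ε)}` preserves the Riemannian submersion `π`. -/
def PreservesSubmersion (gN : SmoothMetric p N) (π : M → N) (ε : ℝ)
    (g : ℝ → SmoothMetric d M) : Prop :=
  ∀ t ∈ Ioo (-ε) ε, IsRiemannianSubmersion (g t) gN π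

/-- For all `t ∈ (-ε, ε)` and all vertical `X`,
`B_t^♯ X = ∑ i, g₀(V_i, X) P_ℋ^t π^* W_i`, with `π^*` the `g₀`-horizontal lift. -/
def SharpEquation {g₀ : SmoothMetric d M} {gN : SmoothMetric p N} {π : M → N}
    (hπ : IsRiemannianSubmersion g₀ gN π) (V : Fin p → SmoothVectorField d M)
    (W : Fin p → SmoothVectorField p N) (ε : ℝ) (g : ℝ → SmoothMetric d M) : Prop :=
  ∀ t ∈ Ioo (-ε) ε, ∀ x : M, ∀ X ∈ verticalSpace d p π x,
    metricDerivSharp g t x X =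
      ∑ i, g₀.inner x (V i x) X • horizontalProj p (g t) π x (horizontalLift hπ (W i) x)

/-- `{g_t, t ∈ (-ε, ε)}` is a variation of `g₀` in `Riem(M, 𝒱, g₀)` that preserves the Riemannian
submersion `π` and satisfies the equation for `B_t^♯` determined by the fields `V_i`, `W_i`. -/
structure IsSolution {g₀ : SmoothMetric d M} {gN : SmoothMetric p N} {π : M → N}
    (hπ : IsRiemannianSubmersion g₀ gN π) (V : Fin p → SmoothVectorField d M)
    (W : Fin p → SmoothVectorField p N) (ε : ℝ) (g : ℝ → SmoothMetric d M) : Prop where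
  isVariation : IsVariation g₀ ε g
  isFixedOnFibers : IsFixedOnFibers p g₀ π ε g
  preservesSubmersion : PreservesSubmersion gN π ε g
  sharpEquation : SharpEquation hπ V W ε g

end Submersion

end

/-! Lowering the index removes the `t`-dependence from the right-hand side of the equation: if `π`
is a Riemannian submersion for `g_t`, then `g_t(P_ℋ^t π^*W_i, Y) = g_N(W_i, π_*Y)`
(`sharpEquation_iff`). So for vertical `X` the derivative of `g_t(X, Y)` is constant in `t`, and
`g_t(X, Y) = g₀(X, Y) + t ∑ g₀(V_i, X) g_N(W_i, π_*Y)` is forced (`IsSolution.inner_vertical`).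

These values give uniqueness: they determine the horizontal space, on which the metric is lifted
from `g_N` (`IsRiemannianSubmersion.eq_of_inner_vertical`).

For existence, pull `g₀` back by the shear `A_t = id + t ∑ g_N(W_i, π_* ·) V_i`. Since the `V_i` are
vertical, `A_t` fixes vertical vectors, commutes with `π_*` and has inverse `A_{-t}`, so the
pullback is a metric for every real `t`, it keeps the submersion, and it has the forced values
(`isSolution_shearedMetric`). -/

set_option linter.unusedSectionVars false

/-! ### Smoothness criteria for families of bilinear forms. -/

section BilinearFormSmoothness

variable {d : ℕ} {M : Type*} [TopologicalSpace M] [ChartedSpace (Eucl d) M]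
  [IsManifold (𝓡 d) ∞ M]
  {F : Type*} [NormedAddCommGroup F] [NormedSpace ℝ F] {H : Type*} [TopologicalSpace H]
  {I : ModelWithCorners ℝ F H} {X : Type*} [TopologicalSpace X] [ChartedSpace H X]

/-- A map into the continuous linear maps on a finite-dimensional space is smooth if it is smooth
pointwise. -/
theorem contMDiffAt_of_clm_apply {E G : Type*} [NormedAddCommGroup E] [NormedSpace ℝ E]
    [FiniteDimensional ℝ E] [NormedAddCommGroup G] [NormedSpace ℝ G]
    {f : X → E →L[ℝ] G} {q : X}
    (h : ∀ v, ContMDiffAt I 𝓘(ℝ, G) ∞ (fun r => f r v) q) :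
    ContMDiffAt I 𝓘(ℝ, E →L[ℝ] G) ∞ f q := by
  let b := Module.finBasis ℝ E
  -- Expanding in a basis writes `f` as a finite sum of fixed continuous linear maps applied to the
  -- smooth functions `f r (b i)`.
  have hf : f = fun r => ∑ i, ContinuousLinearMap.smulRightL ℝ E G
      (LinearMap.toContinuousLinearMap (b.coord i)) (f r (b i)) := by
    funext r
    ext v
    conv_lhs => rw [← b.sum_repr v, map_sum]
    simp
  rw [hf]
  refine contMDiffAt_finsetSum fun i _ => ?_
  exact (ContinuousLinearMap.contMDiff _).contMDiffAt.comp q (h (b i))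

/-- The local vector field that is constant equal to `v` in the tangent bundle trivialization
at `x₀`. -/
noncomputable def localField (x₀ : M) (v : Eucl d) (x : M) : Tan d x :=
  (trivializationAt (Eucl d) (fun x : M => Tan d x) x₀).symm x v

theorem contMDiffAt_localField (x₀ : M) (v : Eucl d) :
    ContMDiffAt (𝓡 d) ((𝓡 d).prod 𝓘(ℝ, Eucl d)) ∞
      (fun x => Bundle.TotalSpace.mk' (Eucl d) (E := fun x : M => Tan d x) x
        (localField x₀ v x)) x₀ := by
  have hx : x₀ ∈ (trivializationAt (Eucl d) (fun x : M => Tan d x) x₀).baseSet :=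
    FiberBundle.mem_baseSet_trivializationAt' x₀
  rw [Bundle.contMDiffAt_section]
  refine (contMDiffAt_const (c := v)).congr_of_eventuallyEq ?_
  filter_upwards [(trivializationAt (Eucl d) (fun x : M => Tan d x) x₀).open_baseSet.mem_nhds hx]
    with y hy
  exact congr_arg Prod.snd
    ((trivializationAt (Eucl d) (fun x : M => Tan d x) x₀).apply_mk_symm hy v)

/-- A family of bilinear forms is smooth if its values on local fields are. -/
theorem contMDiffAt_bilin {f : X → M} {q : X} (hf : ContMDiffAt I (𝓡 d) ∞ f q)
    {b : ∀ r, Tan d (f r) →L[ℝ] Tan d (f r) →L[ℝ] ℝ}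
    (h : ∀ u v, ContMDiffAt I 𝓘(ℝ, ℝ) ∞
      (fun r => b r (localField (f q) u (f r)) (localField (f q) v (f r))) q) :
    ContMDiffAt I ((𝓡 d).prod 𝓘(ℝ, Eucl d →L[ℝ] Eucl d →L[ℝ] ℝ)) ∞
      (fun r => Bundle.TotalSpace.mk' (Eucl d →L[ℝ] Eucl d →L[ℝ] ℝ)
        (E := fun x : M => Tan d x →L[ℝ] Tan d x →L[ℝ] ℝ) (f r) (b r)) q := by
  rw [contMDiffAt_hom_bundle]
  refine ⟨hf, ?_⟩
  refine contMDiffAt_of_clm_apply fun u => contMDiffAt_of_clm_apply fun v => ?_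
  refine (h u v).congr_of_eventuallyEq ?_
  have hx : f q ∈ (trivializationAt (Eucl d) (fun x : M => Tan d x) (f q)).baseSet :=
    FiberBundle.mem_baseSet_trivializationAt' (f q)
  filter_upwards [hf.continuousAt.preimage_mem_nhds
    ((trivializationAt (Eucl d) (fun x : M => Tan d x) (f q)).open_baseSet.mem_nhds hx)] with r hr
  rw [inCoordinates_apply_eq₂ hr hr (Set.mem_univ _)]
  simp [localField]

/-- Evaluating a smooth family of bilinear forms on smooth vector fields gives a smooth
function. -/
theorem contMDiffWithinAt_bilin_apply {f : X → M} {s : Set X} {q : X}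
    {b : ∀ r, Tan d (f r) →L[ℝ] Tan d (f r) →L[ℝ] ℝ} {u v : ∀ r, Tan d (f r)}
    (hb : ContMDiffWithinAt I ((𝓡 d).prod 𝓘(ℝ, Eucl d →L[ℝ] Eucl d →L[ℝ] ℝ)) ∞
      (fun r => Bundle.TotalSpace.mk' (Eucl d →L[ℝ] Eucl d →L[ℝ] ℝ)
        (E := fun x : M => Tan d x →L[ℝ] Tan d x →L[ℝ] ℝ) (f r) (b r)) s q)
    (hu : ContMDiffWithinAt I ((𝓡 d).prod 𝓘(ℝ, Eucl d)) ∞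
      (fun r => Bundle.TotalSpace.mk' (Eucl d) (E := fun x : M => Tan d x) (f r) (u r)) s q)
    (hv : ContMDiffWithinAt I ((𝓡 d).prod 𝓘(ℝ, Eucl d)) ∞
      (fun r => Bundle.TotalSpace.mk' (Eucl d) (E := fun x : M => Tan d x) (f r) (v r)) s q) :
    ContMDiffWithinAt I 𝓘(ℝ, ℝ) ∞ (fun r => b r (u r) (v r)) s q := by
  have : ContMDiffWithinAt I ((𝓡 d).prod 𝓘(ℝ, ℝ)) ∞
      (fun r => Bundle.TotalSpace.mk' ℝ (E := Bundle.Trivial M ℝ) (f r) (b r (u r) (v r))) s q :=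
    ContMDiffWithinAt.clm_bundle_apply₂ (F₁ := Eucl d) (F₂ := Eucl d) hb hu hv
  simp only [Bundle.contMDiffWithinAt_totalSpace] at this
  exact this.2

end BilinearFormSmoothness

/-! ### Differentiating a variation in `t`. -/

section Variation

variable {d : ℕ} {M : Type*} [TopologicalSpace M] [ChartedSpace (Eucl d) M]
  [IsManifold (𝓡 d) ∞ M] {g₀ : SmoothMetric d M} {ε : ℝ} {g : ℝ → SmoothMetric d M}

theorem contDiffOn_inner_apply (hg : IsVariation g₀ ε g) (x : M) (X Y : Tan d x) :
    ContDiffOn ℝ ∞ (fun s => (g s).inner x X Y) (Ioo (-ε) ε) := by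
  intro t ht
  rw [← contMDiffWithinAt_iff_contDiffWithinAt]
  have hc : ∀ Z : Tan d x, ContMDiffWithinAt 𝓘(ℝ, ℝ) ((𝓡 d).prod 𝓘(ℝ, Eucl d)) ∞
      (fun _ : ℝ => Bundle.TotalSpace.mk' (Eucl d) (E := fun x : M => Tan d x) x Z)
      (Ioo (-ε) ε) t := fun Z => contMDiffWithinAt_const
  refine contMDiffWithinAt_bilin_apply (f := fun _ => x) (b := fun s => (g s).inner x)
    ?_ (hc X) (hc Y)
  have h2 : ContMDiffWithinAt 𝓘(ℝ, ℝ) (𝓘(ℝ, ℝ).prod (𝓡 d)) ∞ (fun s : ℝ => (s, x))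
      (Ioo (-ε) ε) t := contMDiffWithinAt_id.prodMk contMDiffWithinAt_const
  exact ContMDiffWithinAt.comp (g := fun q : ℝ × M => Bundle.TotalSpace.mk'
    (Eucl d →L[ℝ] Eucl d →L[ℝ] ℝ) (E := fun x : M => Tan d x →L[ℝ] Tan d x →L[ℝ] ℝ) q.2
    ((g q.1).inner q.2)) (t := Ioo (-ε) ε ×ˢ univ) t (hg.contMDiffOn (t, x) ⟨ht, trivial⟩) h2
    fun s hs => ⟨hs, trivial⟩

theorem HasDerivAt.clm_apply_const {E G : Type*} [NormedAddCommGroup E] [NormedSpace ℝ E]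
    [NormedAddCommGroup G] [NormedSpace ℝ G] {f : ℝ → E →L[ℝ] G} {f' : E →L[ℝ] G} {t : ℝ}
    (h : HasDerivAt f f' t) (u : E) : HasDerivAt (fun r => f r u) (f' u) t := by
  simpa using h.clm_apply (hasDerivAt_const t u)

/-- A curve of bilinear forms that is smooth pointwise can be differentiated pointwise. -/
theorem hasDerivAt_apply_of_contDiffOn_apply {E : Type*} [NormedAddCommGroup E]
    [NormedSpace ℝ E] [FiniteDimensional ℝ E] {f : ℝ → E →L[ℝ] E →L[ℝ] ℝ} {s : Set ℝ}
    (hs : IsOpen s) (h : ∀ u v, ContDiffOn ℝ ∞ (fun r => f r u v) s) {t : ℝ} (ht : t ∈ s)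
    (u v : E) : HasDerivAt (fun r => f r u v) (deriv f t u v) t := by
  -- `deriv f t` defaults to zero unless `f` is differentiable in operator norm; finite dimension
  -- supplies this from the pointwise smoothness.
  have hf : ContDiffOn ℝ ∞ f s :=
    contDiffOn_clm_apply.2 fun u => contDiffOn_clm_apply.2 fun v => h u v
  have hd : HasDerivAt f (deriv f t) t :=
    ((hf.differentiableOn (by decide)).differentiableAt (hs.mem_nhds ht)).hasDerivAt
  exact (HasDerivAt.clm_apply_const (E := E) (G := E →L[ℝ] ℝ) (f := f) (f' := deriv f t)
    hd u).clm_apply_const v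

theorem hasDerivAt_inner_apply (hg : IsVariation g₀ ε g) {t : ℝ} (ht : t ∈ Ioo (-ε) ε) (x : M)
    (X Y : Tan d x) : HasDerivAt (fun s => (g s).inner x X Y) (metricDeriv g t x X Y) t :=
  hasDerivAt_apply_of_contDiffOn_apply (E := Eucl d) (f := fun s => (g s).inner x) isOpen_Ioo
    (contDiffOn_inner_apply hg x) ht X Y

end Variation

/-! ### Lowering the index, and uniqueness. -/

section Submersion

variable {d p : ℕ} {M N : Type*}
  [TopologicalSpace M] [ChartedSpace (Eucl d) M] [IsManifold (𝓡 d) ∞ M]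
  [TopologicalSpace N] [ChartedSpace (Eucl p) N] [IsManifold (𝓡 p) ∞ N]
  {g₀ g g' : SmoothMetric d M} {gN : SmoothMetric p N} {π : M → N}

theorem mem_verticalSpace {x : M} {X : Tan d x} :
    X ∈ verticalSpace d p π x ↔ pushforward d p π x X = 0 := Iff.rfl

theorem mem_horizontalSpace {x : M} {Z : Tan d x} :
    Z ∈ horizontalSpace p g π x ↔ ∀ X ∈ verticalSpace d p π x, g.inner x X Z = 0 := Iff.rfl

theorem exists_vertical_add_horizontal (g : SmoothMetric d M) (π : M → N) (x : M) (X : Tan d x) :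
    ∃ U ∈ verticalSpace d p π x, ∃ Z ∈ horizontalSpace p g π x, U + Z = X :=
  Submodule.mem_sup.1 (by
    rw [(isCompl_vertical_horizontal (p := p) g π x).sup_eq_top]; trivial)

theorem horizontalProj_mem (x : M) (Z : Tan d x) :
    horizontalProj p g π x Z ∈ horizontalSpace p g π x :=
  Submodule.projection_apply_mem _ Z

theorem pushforward_horizontalProj (x : M) (Z : Tan d x) :
    pushforward d p π x (horizontalProj p g π x Z) = pushforward d p π x Z := by
  obtain ⟨U, hU, Y, hY, rfl⟩ := exists_vertical_add_horizontal (p := p) g π x Z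
  have h1 : horizontalProj p g π x U = 0 :=
    (Submodule.projection_apply_eq_zero_iff (isCompl_vertical_horizontal g π x).symm).2 hU
  have h2 : horizontalProj p g π x Y = Y :=
    Submodule.projection_apply_left (isCompl_vertical_horizontal g π x).symm ⟨Y, hY⟩
  rw [map_add, h1, h2, zero_add, map_add, mem_verticalSpace.1 hU, zero_add]

/-- For a Riemannian submersion, the scalar product with a horizontal vector can be computed on
the base. -/
theorem inner_of_mem_horizontal (h : IsRiemannianSubmersion g gN π) {x : M} {Z : Tan d x}
    (hZ : Z ∈ horizontalSpace p g π x) (Y : Tan d x) :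
    g.inner x Z Y = gN.inner (π x) (pushforward d p π x Z) (pushforward d p π x Y) := by
  obtain ⟨U, hU, Y, hY, rfl⟩ := exists_vertical_add_horizontal (p := p) g π x Y
  rw [map_add, map_add, g.symm, mem_horizontalSpace.1 hZ U hU, mem_verticalSpace.1 hU,
    zero_add, zero_add, h.isometry x Z hZ Y hY]

/-- The right-hand side does not involve `g`; this is what makes the lowered equation independent of
`t`. -/
theorem inner_horizontalProj (h : IsRiemannianSubmersion g gN π) (x : M) (Z Y : Tan d x) :
    g.inner x (horizontalProj p g π x Z) Y =
      gN.inner (π x) (pushforward d p π x Z) (pushforward d p π x Y) := by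
  rw [inner_of_mem_horizontal h (horizontalProj_mem x Z), pushforward_horizontalProj]

theorem pushforward_horizontalLift (hπ : IsRiemannianSubmersion g₀ gN π)
    (W : SmoothVectorField p N) (x : M) :
    pushforward d p π x (horizontalLift hπ W x) = W (π x) :=
  (existsUnique_horizontal hπ x (W (π x))).choose_spec.1.2

theorem SmoothMetric.ext_inner (h : ∀ x X Y, g.inner x X Y = g'.inner x X Y) : g = g' := by
  cases g; cases g'
  congr
  funext x
  ext X Y
  exact h x X Y

theorem inner_left_cancel {x : M} {X Y : Tan d x}
    (h : ∀ Z, g.inner x X Z = g.inner x Y Z) : X = Y := by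
  by_contra hne
  refine (g.pos x (X - Y) (sub_ne_zero.2 hne)).ne' ?_
  simp [h]

/-- Two metrics for which `π` is a Riemannian submersion are equal as soon as they agree
on pairs of vectors one of which is vertical. -/
theorem IsRiemannianSubmersion.eq_of_inner_vertical (h : IsRiemannianSubmersion g gN π)
    (h' : IsRiemannianSubmersion g' gN π)
    (hv : ∀ x, ∀ X ∈ verticalSpace d p π x, ∀ Y, g.inner x X Y = g'.inner x X Y) : g = g' := by
  refine SmoothMetric.ext_inner fun x X Y => ?_
  obtain ⟨U, hU, Z, hZ, rfl⟩ := exists_vertical_add_horizontal (p := p) g π x X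
  -- Horizontality only tests pairings with vertical vectors, on which the two metrics agree.
  have hZ' : Z ∈ horizontalSpace p g' π x :=
    mem_horizontalSpace.2 fun X hX => (hv x X hX Z).symm.trans (mem_horizontalSpace.1 hZ X hX)
  rw [map_add, map_add, add_apply, add_apply, hv x U hU,
    inner_of_mem_horizontal h hZ, inner_of_mem_horizontal h' hZ']

/-- The equation for `B_t^♯`, with the index lowered. -/
theorem sharpEquation_iff (hπ : IsRiemannianSubmersion g₀ gN π)
    (V : Fin p → SmoothVectorField d M) (W : Fin p → SmoothVectorField p N) {ε : ℝ}
    {g : ℝ → SmoothMetric d M} (hg : PreservesSubmersion gN π ε g) :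
    SharpEquation hπ V W ε g ↔ ∀ t ∈ Ioo (-ε) ε, ∀ x, ∀ X ∈ verticalSpace d p π x, ∀ Y,
      metricDeriv g t x X Y = ∑ i, g₀.inner x (V i x) X *
        gN.inner (π x) (W i (π x)) (pushforward d p π x Y) := by
  refine forall₂_congr fun t ht => forall_congr' fun x => forall₂_congr fun X hX => ?_
  have key : ∀ Y, (g t).inner x (∑ i, g₀.inner x (V i x) X •
      horizontalProj p (g t) π x (horizontalLift hπ (W i) x)) Y =
      ∑ i, g₀.inner x (V i x) X * gN.inner (π x) (W i (π x)) (pushforward d p π x Y) := by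
    intro Y
    simp [inner_horizontalProj (hg t ht), pushforward_horizontalLift]
  constructor
  · intro h Y
    rw [← key, ← h, metricDerivSharp, inner_sharp]
  · intro h
    refine inner_left_cancel (g := g t) fun Y => ?_
    rw [key, ← h, metricDerivSharp, inner_sharp]

theorem IsSolution.inner_vertical (hπ : IsRiemannianSubmersion g₀ gN π)
    {V : Fin p → SmoothVectorField d M} {W : Fin p → SmoothVectorField p N} {ε : ℝ}
    {g : ℝ → SmoothMetric d M} (hg : IsSolution hπ V W ε g) {t : ℝ} (ht : t ∈ Ioo (-ε) ε)
    (x : M) {X : Tan d x} (hX : X ∈ verticalSpace d p π x) (Y : Tan d x) :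
    (g t).inner x X Y = g₀.inner x X Y + t * ∑ i, g₀.inner x (V i x) X *
        gN.inner (π x) (W i (π x)) (pushforward d p π x Y) := by
  set c := ∑ i, g₀.inner x (V i x) X * gN.inner (π x) (W i (π x)) (pushforward d p π x Y)
  have h0 : (0 : ℝ) ∈ Ioo (-ε) ε := by
    have := ht.1.trans ht.2
    constructor <;> linarith
  -- The prescribed derivative `c` does not depend on `s`, so subtracting `s * c` leaves a constant
  -- function.
  have hd : ∀ s ∈ Ioo (-ε) ε, HasDerivAt (fun s => (g s).inner x X Y - s * c) 0 s := by
    intro s hs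
    have h1 := hasDerivAt_inner_apply hg.isVariation hs x X Y
    rw [(sharpEquation_iff hπ V W hg.preservesSubmersion).1 hg.sharpEquation s hs x X hX Y] at h1
    convert! h1.sub ((hasDerivAt_id s).mul_const c) using 1
    simp [c]
  have h2 := isOpen_Ioo.is_const_of_deriv_eq_zero isPreconnected_Ioo
    (fun s hs => (hd s hs).differentiableAt.differentiableWithinAt)
    (fun s hs => (hd s hs).deriv) ht h0
  simp only [hg.isVariation.zero, zero_mul, sub_zero] at h2
  linarith

theorem IsSolution.eqOn (hπ : IsRiemannianSubmersion g₀ gN π)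
    {V : Fin p → SmoothVectorField d M} {W : Fin p → SmoothVectorField p N} {ε : ℝ}
    {g g' : ℝ → SmoothMetric d M} (hg : IsSolution hπ V W ε g) (hg' : IsSolution hπ V W ε g') :
    EqOn g g' (Ioo (-ε) ε) := fun t ht =>
  (hg.preservesSubmersion t ht).eq_of_inner_vertical (hg'.preservesSubmersion t ht)
    fun x X hX Y => by rw [hg.inner_vertical hπ ht x hX Y, hg'.inner_vertical hπ ht x hX Y]

end Submersion

/-! ### Existence: pulling back `g₀` by a vertical shear. -/

section Shear

variable {d p : ℕ} {M N : Type*}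
  [TopologicalSpace M] [ChartedSpace (Eucl d) M] [IsManifold (𝓡 d) ∞ M]
  [TopologicalSpace N] [ChartedSpace (Eucl p) N] [IsManifold (𝓡 p) ∞ N]
  {g₀ : SmoothMetric d M} {gN : SmoothMetric p N} {π : M → N}

/-- The covector `X ↦ g_N (W, π_* X)`. -/
noncomputable def baseCovector (gN : SmoothMetric p N) (π : M → N) (W : SmoothVectorField p N)
    (x : M) : Tan d x →L[ℝ] ℝ :=
  (gN.inner (π x) (W (π x))).comp (pushforward d p π x)

theorem baseCovector_apply (W : SmoothVectorField p N) (x : M) (X : Tan d x) :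
    baseCovector gN π W x X = gN.inner (π x) (W (π x)) (pushforward d p π x X) := rfl

theorem contMDiffAt_baseCovector (hπ : ContMDiff (𝓡 d) (𝓡 p) ∞ π) (W : SmoothVectorField p N)
    {X : ∀ x : M, Tan d x} {x₀ : M}
    (hX : ContMDiffAt (𝓡 d) ((𝓡 d).prod 𝓘(ℝ, Eucl d)) ∞
      (fun x => Bundle.TotalSpace.mk' (Eucl d) (E := fun x : M => Tan d x) x (X x)) x₀) :
    ContMDiffAt (𝓡 d) 𝓘(ℝ, ℝ) ∞ (fun x => baseCovector gN π W x (X x)) x₀ := by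
  refine contMDiffWithinAt_bilin_apply (s := univ) (f := π) (b := fun x => gN.inner (π x))
    (u := fun x => W (π x)) (v := fun x => pushforward d p π x (X x)) ?_ ?_ ?_
  · exact (gN.contMDiff.comp hπ).contMDiffAt
  · exact (W.contMDiff.comp hπ).contMDiffAt
  -- The pushed-forward field is the tangent map of `π` composed with the section `X`.
  · exact ((hπ.contMDiff_tangentMap (m := ∞) (by simp)).contMDiffAt).comp x₀ hX

/-- The endomorphism `X ↦ X + t ∑ i, g_N (W_i, π_* X) V_i` of the tangent space. -/
noncomputable def shear (gN : SmoothMetric p N) (π : M → N) (V : Fin p → SmoothVectorField d M)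
    (W : Fin p → SmoothVectorField p N) (t : ℝ) (x : M) : Tan d x →L[ℝ] Tan d x :=
  ContinuousLinearMap.id ℝ (Tan d x) +
    t • ∑ i, (baseCovector gN π (W i) x).smulRight (V i x)

variable {V : Fin p → SmoothVectorField d M} {W : Fin p → SmoothVectorField p N}

theorem shear_apply (t : ℝ) (x : M) (X : Tan d x) :
    shear gN π V W t x X = X + t • ∑ i, baseCovector gN π (W i) x X • V i x := by
  simp [shear]

theorem shear_zero (x : M) (X : Tan d x) : shear gN π V W 0 x X = X := by
  simp [shear_apply]

theorem shear_of_mem_vertical (t : ℝ) {x : M} {X : Tan d x} (hX : X ∈ verticalSpace d p π x) :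
    shear gN π V W t x X = X := by
  simp [shear_apply, baseCovector_apply, mem_verticalSpace.1 hX]

theorem pushforward_shear (hV : ∀ i, ∀ x : M, V i x ∈ verticalSpace d p π x) (t : ℝ) (x : M)
    (X : Tan d x) : pushforward d p π x (shear gN π V W t x X) = pushforward d p π x X := by
  simp [shear_apply, mem_verticalSpace.1 (hV _ x)]

/-- The first shear leaves `π_* X`, hence the coefficients of the `V_i`, unchanged, so the two added
terms cancel. -/
theorem shear_neg_shear (hV : ∀ i, ∀ x : M, V i x ∈ verticalSpace d p π x) (t : ℝ) (x : M)
    (X : Tan d x) : shear gN π V W (-t) x (shear gN π V W t x X) = X := by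
  rw [shear_apply (-t)]
  simp only [baseCovector_apply, pushforward_shear hV]
  simp [shear_apply, baseCovector_apply]

theorem inner_shear (t : ℝ) (x : M) (X Y : Tan d x) :
    g₀.inner x (shear gN π V W t x X) (shear gN π V W t x Y) =
      g₀.inner x X Y + t * ∑ i, baseCovector gN π (W i) x Y * g₀.inner x X (V i x) +
      t * ∑ i, baseCovector gN π (W i) x X * g₀.inner x (V i x) Y +
      t * (t * ∑ i, ∑ j, baseCovector gN π (W i) x Y * (baseCovector gN π (W j) x X *
        g₀.inner x (V j x) (V i x))) := by
  simp only [shear_apply, map_add, map_smul, map_sum, add_apply, smul_apply, sum_apply,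
    smul_eq_mul, Finset.mul_sum]
  simp only [Finset.sum_add_distrib, mul_add, Finset.mul_sum]
  ring_nf

variable (g₀ gN π V W) in
/-- The pullback of `g₀` by the shear, as a family of bilinear forms. -/
noncomputable def shearedInner (t : ℝ) (x : M) : Tan d x →L[ℝ] Tan d x →L[ℝ] ℝ :=
  ((shear gN π V W t x).precomp ℝ).comp ((g₀.inner x).comp (shear gN π V W t x))

theorem shearedInner_apply (t : ℝ) (x : M) (X Y : Tan d x) :
    shearedInner g₀ gN π V W t x X Y =
      g₀.inner x (shear gN π V W t x X) (shear gN π V W t x Y) := rfl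

theorem contMDiff_shearedInner (hπ : ContMDiff (𝓡 d) (𝓡 p) ∞ π) :
    ContMDiff (𝓘(ℝ, ℝ).prod (𝓡 d)) ((𝓡 d).prod 𝓘(ℝ, Eucl d →L[ℝ] Eucl d →L[ℝ] ℝ)) ∞
      (fun q : ℝ × M => Bundle.TotalSpace.mk' (Eucl d →L[ℝ] Eucl d →L[ℝ] ℝ)
        (E := fun x : M => Tan d x →L[ℝ] Tan d x →L[ℝ] ℝ) q.2
        (shearedInner g₀ gN π V W q.1 q.2)) := by
  rintro ⟨t, x₀⟩
  refine contMDiffAt_bilin (f := Prod.snd) (b := fun q => shearedInner g₀ gN π V W q.1 q.2)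
    contMDiffAt_snd fun u v => ?_
  -- The expansion is a polynomial in `t` whose coefficients are functions on `M` alone, so joint
  -- smoothness reduces to smoothness at `x₀`.
  simp only [shearedInner_apply, inner_shear]
  have hsnd : ∀ {h : M → ℝ}, ContMDiffAt (𝓡 d) 𝓘(ℝ, ℝ) ∞ h x₀ →
      ContMDiffAt (𝓘(ℝ, ℝ).prod (𝓡 d)) 𝓘(ℝ, ℝ) ∞ (fun q : ℝ × M => h q.2) (t, x₀) :=
    fun hh => ContMDiffAt.comp (t, x₀) hh contMDiffAt_snd
  have hfst : ContMDiffAt (𝓘(ℝ, ℝ).prod (𝓡 d)) 𝓘(ℝ, ℝ) ∞ (fun q : ℝ × M => q.1) (t, x₀) :=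
    contMDiffAt_fst
  have hu := contMDiffAt_localField x₀ u
  have hv := contMDiffAt_localField x₀ v
  have hα : ∀ (w : Eucl d) i, ContMDiffAt (𝓘(ℝ, ℝ).prod (𝓡 d)) 𝓘(ℝ, ℝ) ∞
      (fun q : ℝ × M => baseCovector gN π (W i) q.2 (localField x₀ w q.2)) (t, x₀) :=
    fun w i => hsnd (h := fun x => baseCovector gN π (W i) x (localField x₀ w x))
      (contMDiffAt_baseCovector hπ (W i) (contMDiffAt_localField x₀ w))
  have hg : ∀ X Y : ∀ x : M, Tan d x,
      ContMDiffAt (𝓡 d) ((𝓡 d).prod 𝓘(ℝ, Eucl d)) ∞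
        (fun x => Bundle.TotalSpace.mk' (Eucl d) (E := fun x : M => Tan d x) x (X x)) x₀ →
      ContMDiffAt (𝓡 d) ((𝓡 d).prod 𝓘(ℝ, Eucl d)) ∞
        (fun x => Bundle.TotalSpace.mk' (Eucl d) (E := fun x : M => Tan d x) x (Y x)) x₀ →
      ContMDiffAt (𝓘(ℝ, ℝ).prod (𝓡 d)) 𝓘(ℝ, ℝ) ∞
        (fun q : ℝ × M => g₀.inner q.2 (X q.2) (Y q.2)) (t, x₀) :=
    fun X Y hX hY => hsnd (h := fun x => g₀.inner x (X x) (Y x))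
      (contMDiffWithinAt_bilin_apply (s := univ) (f := fun x => x) (b := fun x => g₀.inner x)
        g₀.contMDiff.contMDiffAt hX hY)
  have hVs := fun i => (V i).contMDiff.contMDiffAt (x := x₀)
  refine ((ContMDiffAt.add ?_ ?_).add ?_).add ?_
  · exact hg _ _ hu hv
  · exact hfst.mul (contMDiffAt_finsetSum fun i _ => (hα v i).mul (hg _ _ hu (hVs i)))
  · exact hfst.mul (contMDiffAt_finsetSum fun i _ => (hα u i).mul (hg _ _ (hVs i) hv))
  · exact hfst.mul (hfst.mul (contMDiffAt_finsetSum fun i _ => contMDiffAt_finsetSum fun j _ =>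
      (hα v i).mul ((hα u j).mul (hg _ _ (hVs j) (hVs i)))))

variable (g₀ gN) in
/-- The pullback of `g₀` by the shear, as a family of Riemannian metrics. -/
noncomputable def shearedMetric (hπ : ContMDiff (𝓡 d) (𝓡 p) ∞ π)
    (hV : ∀ i, ∀ x : M, V i x ∈ verticalSpace d p π x) (W : Fin p → SmoothVectorField p N)
    (t : ℝ) : SmoothMetric d M where
  inner := shearedInner g₀ gN π V W t
  symm x X Y := g₀.symm x _ _
  pos x X hX := g₀.pos x _ fun h => hX (by
    have h0 : shear gN π V W t x X = 0 := h
    rw [← shear_neg_shear (gN := gN) (W := W) hV t x X, h0, map_zero])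
  isVonNBounded x := by
    -- The unit ball of the pullback lies in the image of the `g₀`-unit ball under the inverse
    -- shear.
    refine ((g₀.isVonNBounded x).image (shear gN π V W (-t) x)).subset fun X hX => ?_
    exact ⟨shear gN π V W t x X, hX, shear_neg_shear hV t x X⟩
  contMDiff := (contMDiff_shearedInner hπ).comp (contMDiff_const.prodMk contMDiff_id)

theorem shearedMetric_inner (hπ : ContMDiff (𝓡 d) (𝓡 p) ∞ π)
    (hV : ∀ i, ∀ x : M, V i x ∈ verticalSpace d p π x) (t : ℝ) (x : M) (X Y : Tan d x) :
    (shearedMetric g₀ gN hπ hV W t).inner x X Y =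
      g₀.inner x (shear gN π V W t x X) (shear gN π V W t x Y) := rfl

theorem isVariation_shearedMetric (hπ : ContMDiff (𝓡 d) (𝓡 p) ∞ π)
    (hV : ∀ i, ∀ x : M, V i x ∈ verticalSpace d p π x) (ε : ℝ) :
    IsVariation g₀ ε (shearedMetric g₀ gN hπ hV W) where
  zero := SmoothMetric.ext_inner fun x X Y => by simp only [shearedMetric_inner, shear_zero]
  contMDiffOn := (contMDiff_shearedInner hπ).contMDiffOn

theorem isRiemannianSubmersion_shearedMetric (hπ : IsRiemannianSubmersion g₀ gN π)
    (hV : ∀ i, ∀ x : M, V i x ∈ verticalSpace d p π x) (t : ℝ) :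
    IsRiemannianSubmersion (shearedMetric g₀ gN hπ.contMDiff hV W t) gN π where
  contMDiff := hπ.contMDiff
  surjective := hπ.surjective
  isometry x X hX Y _ := by
    -- A vertical `Z` is its own shear, so pairing it with the sheared `X` in `g₀` is pairing it
    -- with `X` in the pullback.
    have hX' : shear gN π V W t x X ∈ horizontalSpace p g₀ π x := by
      refine mem_horizontalSpace.2 fun Z hZ => ?_
      rw [← mem_horizontalSpace.1 hX Z hZ, shearedMetric_inner, shear_of_mem_vertical t hZ]
    rw [shearedMetric_inner, inner_of_mem_horizontal hπ hX', pushforward_shear hV,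
      pushforward_shear hV]

theorem isSolution_shearedMetric (hπ : IsRiemannianSubmersion g₀ gN π)
    (hV : ∀ i, ∀ x : M, V i x ∈ verticalSpace d p π x) (ε : ℝ) :
    IsSolution hπ V W ε (shearedMetric g₀ gN hπ.contMDiff hV W) where
  isVariation := isVariation_shearedMetric hπ.contMDiff hV ε
  isFixedOnFibers t _ x X hX Y hY := by
    rw [shearedMetric_inner, shear_of_mem_vertical t hX, shear_of_mem_vertical t hY]
  preservesSubmersion t _ := isRiemannianSubmersion_shearedMetric hπ hV t
  sharpEquation := by
    refine (sharpEquation_iff hπ V W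
      fun t _ => isRiemannianSubmersion_shearedMetric hπ hV t).2 fun t ht x X hX Y => ?_
    -- For vertical `X` the shear acts only on `Y`, so the pairing is affine in `t` with the
    -- required slope.
    refine (hasDerivAt_inner_apply (isVariation_shearedMetric hπ.contMDiff hV ε) ht x X Y).unique ?_
    set c := ∑ i, g₀.inner x (V i x) X *
      gN.inner (π x) (W i (π x)) (pushforward d p π x Y) with hc
    have h : (fun s => (shearedMetric g₀ gN hπ.contMDiff hV W s).inner x X Y) =
        fun s => g₀.inner x X Y + s * c := by
      funext s
      rw [shearedMetric_inner, shear_of_mem_vertical s hX, shear_apply, hc]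
      simp [baseCovector_apply, g₀.symm x X, mul_comm]
    rw [h]
    simpa using ((hasDerivAt_id t).mul_const c).const_add (g₀.inner x X Y)

end Shear

theorem theorem3p5 {n p : ℕ} {M N : Type*}
    [TopologicalSpace M] [ChartedSpace (Eucl (n + p)) M] [IsManifold (𝓡 (n + p)) ∞ M]
    [TopologicalSpace N] [ChartedSpace (Eucl p) N] [IsManifold (𝓡 p) ∞ N]
    (g₀ : SmoothMetric (n + p) M) (gN : SmoothMetric p N) (π : M → N)
    (hπ : IsRiemannianSubmersion g₀ gN π)
    (V : Fin p → SmoothVectorField (n + p) M)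
    (hV : ∀ i, ∀ x : M, V i x ∈ verticalSpace (n + p) p π x)
    (hV_bdd : ∀ i, IsBoundedField g₀ (V i))
    (W : Fin p → SmoothVectorField p N)
    (hW : ∀ y : N, LinearIndependent ℝ (fun i => W i y))
    (hW_bdd : ∀ i, IsBoundedField gN (W i)) :
    (∃ ε > 0, ∃ g : ℝ → SmoothMetric (n + p) M, IsSolution hπ V W ε g) ∧
    ∀ ε > 0, ∀ g g' : ℝ → SmoothMetric (n + p) M,
      IsSolution hπ V W ε g → IsSolution hπ V W ε g' → EqOn g g' (Ioo (-ε) ε) := by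
  -- The choice `ε = 1` is arbitrary: the sheared metrics solve the problem on every interval.
  exact ⟨⟨1, one_pos, _, isSolution_shearedMetric hπ hV 1⟩, fun _ _ _ _ hg hg' => hg.eqOn hπ hg'⟩
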